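/- Fix an integer $a\ge 2$ and let $X_1,X_2,\dots$ be i.i.d. letters, uniformly distributed on $\{1,\dots,a\}$. Call a finite string over $\{1,\dots,a\}$ $k$-omni if each of the $a^k$ words of length $k$ over $\{1,\dots,a\}$ occurs in it as a (not necessarily contiguous) subsequence, and let $W_{k,a}$ be the least $n$ such that the string $X_1X_2\cdots X_n$ is $k$-omni ($\infty$ if there is none). Then $W_{k,a}$ is almost surely finite for every $k$, the waiting time $W_{1,a}$ until every letter has occurred (a single coupon collection) is square integrable with standard deviation $S:=\sqrt{\operatorname{Var}(W_{1,a})}>0$, and for every real $x$ $$\lim_{k\to\infty}\mathbb P\left(\frac{W_{k,a}-ka\,H(1..a)}{\sqrt{k}\,S}\le x\right)=\frac{1}{\sqrt{2\pi}}\int_{-\infty}^{x}e^{-u^2/2}\,du,\qquad H(1..a):=\sum_{i=1}^{a}\frac1i .$$ -/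

import Mathlib

open MeasureTheory ProbabilityTheory Filter Topology

/-- A finite string over the alphabet `α` is `k`-omni if every word of length `k` over `α` occurs
in it as a (not necessarily contiguous) subsequence. -/
def IsOmni {α : Type*} (k : ℕ) (s : List α) : Prop :=
  ∀ w : List α, w.length = k → w.Sublist s

/-- The waiting time until the letter sequence `x 0, x 1, x 2, …` becomes `k`-omni: the least `n`
such that the string of the first `n` letters is `k`-omni, and `⊤` if there is no such `n`. -/
noncomputable def omniTime {α : Type*} (k : ℕ) (x : ℕ → α) : ℕ∞ :=
  ⨅ (n : ℕ) (_ : IsOmni k ((List.range n).map x)), (n : ℕ∞)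

/-- The waiting time until the sequence becomes `k`-omni, as a real number
(with the value `0` where the waiting time is infinite). -/
noncomputable def omniTimeReal {α : Type*} (k : ℕ) (x : ℕ → α) : ℝ :=
  ((omniTime k x).toNat : ℝ)

/-- The standard deviation under `P` of the waiting time until the random letter sequence `X`
becomes `1`-omni, that is, until every letter has occurred (a single coupon collection). -/
noncomputable def couponStdDev {α Ω : Type*} [MeasurableSpace Ω] (X : ℕ → Ω → α)
    (P : Measure Ω) : ℝ :=
  √(Var[fun ω ↦ omniTimeReal 1 (fun n ↦ X n ω); P])

open scoped ENNReal

/-! The waiting time is a random walk whose steps are coupon collections. Let `N` be the first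
moment when all letters have occurred. The letter at `N` is new, so a word beginning with it cannot
start matching earlier, whereas every other first letter is matched by then. Hence a string is
`(k+1)`-omni exactly when its part after `N` is `k`-omni (`omniTime_succ`).

Since `N` is an almost surely finite stopping time, the sequence after `N` is independent of `N` and
again i.i.d. uniform (`map_stopping_seqShift`). So the law for `k+1` is the convolution of the laws
for `1` and `k` (`map_omniTimeReal_succ`), and the waiting time for `k` is distributed as a sum of
`k` independent coupon collections (`map_omniTimeReal_eq_map_sum`).

The central limit theorem then applies. One collection has geometric tails, hence is square
integrable (`memLp_coverTime`); its mean is `a` times the harmonic number (`integral_coverTime`, by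
first-step analysis over all target sets of letters); and it is not almost surely constant
(`variance_omniTimeReal_one_pos`). -/

lemma iInf_natCast_le_iff {p : ℕ → Prop} (hp : ∀ m n, m ≤ n → p m → p n) (n : ℕ) :
    (⨅ (m : ℕ) (_ : p m), (m : ℕ∞)) ≤ n ↔ p n := by
  constructor
  · intro h
    by_contra hn
    have h1 : ((n + 1 : ℕ) : ℕ∞) ≤ ⨅ (m : ℕ) (_ : p m), (m : ℕ∞) := by
      refine le_iInf₂ fun m hm ↦ ?_
      have : n < m := by
        by_contra h2
        exact hn (hp m n (by omega) hm)
      exact_mod_cast this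
    have h2 := h1.trans h
    norm_cast at h2
    omega
  · exact fun h ↦ iInf₂_le n h

lemma ENat.eq_of_forall_le_natCast_iff {b c : ℕ∞} (h : ∀ n : ℕ, b ≤ n ↔ c ≤ n) : b = c := by
  have key : ∀ {b c : ℕ∞}, (∀ n : ℕ, b ≤ n ↔ c ≤ n) → c ≤ b := by
    intro b c h
    induction b using ENat.recTopCoe with
    | top => exact le_top
    | coe n => exact (h n).1 le_rfl
  exact le_antisymm (key fun n ↦ (h n).symm) (key h)

/-! ### Combinatorics of omni strings and waiting times of a fixed sequence. -/

section Words

variable {α : Type*}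

/-- The sequence with its first `n` letters removed. -/
def seqShift (n : ℕ) (x : ℕ → α) : ℕ → α := fun m ↦ x (n + m)

lemma map_range_add (x : ℕ → α) (m n : ℕ) :
    (List.range (m + n)).map x = (List.range m).map x ++ (List.range n).map (seqShift m x) := by
  simp [List.range_add, seqShift, Function.comp_def]

lemma IsOmni.append {k : ℕ} {s : List α} (h : IsOmni k s) (t : List α) : IsOmni k (s ++ t) :=
  fun w hw ↦ (h w hw).trans (List.sublist_append_left s t)

lemma isOmni_map_range_mono (k : ℕ) (x : ℕ → α) (m n : ℕ) (hmn : m ≤ n)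
    (h : IsOmni k ((List.range m).map x)) : IsOmni k ((List.range n).map x) := by
  obtain ⟨d, rfl⟩ := Nat.exists_eq_add_of_le hmn
  rw [map_range_add]
  exact h.append _

lemma omniTime_le_iff (k : ℕ) (x : ℕ → α) (n : ℕ) :
    omniTime k x ≤ n ↔ IsOmni k ((List.range n).map x) :=
  iInf_natCast_le_iff (isOmni_map_range_mono k x) n

lemma isOmni_one_iff (s : List α) : IsOmni 1 s ↔ ∀ i, i ∈ s := by
  constructor
  · intro h i
    simpa using h [i] rfl
  · intro h w hw
    obtain ⟨i, rfl⟩ := List.length_eq_one_iff.1 hw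
    simpa using h i

lemma omniTime_zero (x : ℕ → α) : omniTime 0 x = 0 := by
  have : omniTime 0 x ≤ (0 : ℕ) := by
    rw [omniTime_le_iff]
    intro w hw
    simp [List.length_eq_zero_iff.1 hw]
  simpa using this

/-- Constant words already force every letter to occur. -/
lemma IsOmni.of_succ [Nonempty α] {k : ℕ} {s : List α} (h : IsOmni (k + 1) s) : IsOmni 1 s := by
  rw [isOmni_one_iff]
  intro i
  exact (h (List.replicate (k + 1) i) (by simp)).subset (by simp)

lemma IsOmni.cons_of_append {k : ℕ} {s t : List α} (hs : IsOmni 1 s) (ht : IsOmni k t) :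
    IsOmni (k + 1) (s ++ t) := by
  intro w hw
  obtain ⟨i, w, rfl⟩ := List.exists_cons_of_length_eq_add_one hw
  have : [i].Sublist s := hs [i] rfl
  simpa using this.append (ht w (by simpa using hw))

/-- As `c` is absent from `u`, an embedding of `c :: w` matches its first letter at the displayed
`c` or later, which leaves only `v` for `w`. -/
lemma IsOmni.of_append_cons {k : ℕ} {u v : List α} {c : α} (h : IsOmni (k + 1) (u ++ c :: v))
    (hc : c ∉ u) : IsOmni k v := by
  intro w hw
  have h1 := h (c :: w) (by simp [hw])
  clear h
  induction u with
  | nil => simpa using h1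
  | cons b u ih =>
    rw [List.cons_append] at h1
    simp only [List.mem_cons, not_or] at hc
    cases h1 with
    | cons _ h => exact ih hc.2 h
    | cons_cons _ h => exact absurd rfl hc.1

/-- The waiting time splits at the first moment when all the letters have occurred. -/
lemma omniTime_succ [Nonempty α] (k : ℕ) (x : ℕ → α) :
    omniTime (k + 1) x = omniTime 1 x + omniTime k (seqShift (omniTime 1 x).toNat x) := by
  obtain h | ⟨N, hN⟩ : omniTime 1 x = ⊤ ∨ ∃ N : ℕ, (N : ℕ∞) = omniTime 1 x := by
    cases h : omniTime 1 x using ENat.recTopCoe with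
    | top => exact Or.inl rfl
    | coe n => exact Or.inr ⟨n, rfl⟩
  · rw [h, top_add]
    by_contra hne
    obtain ⟨n, hn⟩ := ENat.ne_top_iff_exists.1 hne
    have h1 := (omniTime_le_iff (k + 1) x n).1 hn.ge
    have h2 := (omniTime_le_iff 1 x n).2 h1.of_succ
    simp [h] at h2
  rw [← hN, ENat.toNat_natCast]
  have hfull : IsOmni 1 ((List.range N).map x) := (omniTime_le_iff 1 x N).1 hN.ge
  apply ENat.eq_of_forall_le_natCast_iff
  intro n
  by_cases hn : N ≤ n
  · obtain ⟨d, rfl⟩ := Nat.exists_eq_add_of_le hn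
    have : ((N : ℕ∞) + omniTime k (seqShift N x) ≤ (N + d : ℕ)) ↔
        omniTime k (seqShift N x) ≤ d := by
      push_cast
      exact ENat.add_le_add_iff_left (ENat.natCast_ne_top N)
    rw [this, omniTime_le_iff, omniTime_le_iff, map_range_add]
    refine ⟨fun h ↦ ?_, fun h ↦ hfull.cons_of_append h⟩
    -- `N = 0` is impossible because the alphabet is nonempty, so there is a last letter `x M` of
    -- the first collection.
    obtain _ | M := N
    · have := (isOmni_one_iff _).1 hfull (Classical.arbitrary α)
      simp at this
    have hM : ¬ IsOmni 1 ((List.range M).map x) := by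
      rw [← omniTime_le_iff, ← hN]
      norm_cast
      omega
    -- By minimality of `N = M + 1`, the letter completing the collection is new.
    have hc : x M ∉ (List.range M).map x := by
      intro hmem
      apply hM
      rw [isOmni_one_iff] at hfull ⊢
      intro i
      have := hfull i
      rw [List.range_succ, List.map_append, List.mem_append] at this
      obtain h1 | h1 := this
      · exact h1
      · simp only [List.map_cons, List.map_nil, List.mem_singleton] at h1
        exact h1 ▸ hmem
    refine IsOmni.of_append_cons (u := (List.range M).map x) (c := x M) ?_ hc
    simpa [List.range_succ] using h
  · refine iff_of_false (fun h ↦ hn ?_) (fun h ↦ hn ?_)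
    · have h1 := (omniTime_le_iff (k + 1) x n).1 h
      have h2 := (omniTime_le_iff 1 x n).2 h1.of_succ
      rw [← hN] at h2
      exact_mod_cast h2
    · exact_mod_cast le_self_add.trans h

/-- The waiting time until every letter of `S` has occurred. -/
noncomputable def coverTime (S : Finset α) (x : ℕ → α) : ℕ∞ :=
  ⨅ (n : ℕ) (_ : ∀ i ∈ S, i ∈ (List.range n).map x), (n : ℕ∞)

lemma coverTime_le_iff (S : Finset α) (x : ℕ → α) (n : ℕ) :
    coverTime S x ≤ n ↔ ∀ i ∈ S, i ∈ (List.range n).map x := by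
  refine iInf_natCast_le_iff (p := fun n ↦ ∀ i ∈ S, i ∈ (List.range n).map x) ?_ n
  intro m n hmn h i hi
  obtain ⟨d, rfl⟩ := Nat.exists_eq_add_of_le hmn
  rw [map_range_add]
  exact List.mem_append_left _ (h i hi)

lemma omniTime_one [Fintype α] (x : ℕ → α) : omniTime 1 x = coverTime Finset.univ x := by
  apply ENat.eq_of_forall_le_natCast_iff
  intro n
  simp only [omniTime_le_iff, coverTime_le_iff, isOmni_one_iff, Finset.mem_univ, true_imp_iff]

lemma coverTime_empty (x : ℕ → α) : coverTime ∅ x = 0 := by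
  have : coverTime ∅ x ≤ (0 : ℕ) := by
    rw [coverTime_le_iff]
    simp
  simpa using this

/-- First-step decomposition, the source of the recursion for the mean. If `x 0` is outside `S`, the
erasure changes nothing. -/
lemma coverTime_of_nonempty [DecidableEq α] {S : Finset α} (hS : S.Nonempty) (x : ℕ → α) :
    coverTime S x = 1 + coverTime (S.erase (x 0)) (seqShift 1 x) := by
  apply ENat.eq_of_forall_le_natCast_iff
  intro n
  obtain _ | n := n
  · refine iff_of_false (fun h ↦ ?_) (fun h ↦ ?_)
    · obtain ⟨i, hi⟩ := hS
      simpa using (coverTime_le_iff S x 0).1 h i hi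
    · simpa using le_self_add.trans h
  · have : (1 + coverTime (S.erase (x 0)) (seqShift 1 x) ≤ (n + 1 : ℕ)) ↔
        coverTime (S.erase (x 0)) (seqShift 1 x) ≤ n := by
      rw [add_comm]
      push_cast
      exact ENat.add_le_add_iff_right ENat.one_ne_top
    rw [this, coverTime_le_iff, coverTime_le_iff, add_comm n 1, map_range_add]
    simp only [List.mem_append, Finset.mem_erase, and_imp]
    refine forall_congr' fun i ↦ ?_
    simp
    tauto

end Words

lemma ENat.measurableSet_eq_natCast {Ω : Type*} {m : MeasurableSpace Ω} {f : Ω → ℕ∞} {n : ℕ}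
    (h : ∀ k ≤ n, MeasurableSet[m] {x | f x ≤ (k : ℕ)}) : MeasurableSet[m] {x | f x = n} := by
  obtain _ | n := n
  · simpa using h 0 le_rfl
  · convert (h (n + 1) le_rfl).diff (h n n.le_succ) using 1
    ext x
    simp only [Set.mem_sdiff, Set.mem_ofPred_eq]
    cases f x using ENat.recTopCoe with
    | top =>
      exact iff_of_false (ENat.top_ne_natCast _)
        fun h ↦ ENat.top_ne_natCast _ (top_le_iff.1 h.1).symm
    | coe a => norm_cast; omega

lemma ENat.measurable_of_le_natCast {Ω : Type*} {m : MeasurableSpace Ω} {f : Ω → ℕ∞}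
    (h : ∀ n : ℕ, MeasurableSet[m] {x | f x ≤ n}) : Measurable[m] f :=
  ENat.measurable_iff.2 fun _ ↦ ENat.measurableSet_eq_natCast fun k _ ↦ h k

/-! ### Measurability of waiting times, which are stopping times. -/

section Sequences

variable {α : Type*} [MeasurableSpace α]

/-- The σ-algebra on sequences generated by the letters with index in `I`. -/
abbrev lettersSigma (α : Type*) [MeasurableSpace α] (I : Set ℕ) : MeasurableSpace (ℕ → α) :=
  ⨆ i ∈ I, MeasurableSpace.comap (fun x : ℕ → α ↦ x i) inferInstance

lemma lettersSigma_le (I : Set ℕ) : lettersSigma α I ≤ MeasurableSpace.pi :=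
  iSup₂_le fun i _ ↦ (measurable_pi_apply i).comap_le

lemma lettersSigma_mono {I J : Set ℕ} (h : I ⊆ J) : lettersSigma α I ≤ lettersSigma α J :=
  biSup_mono h

lemma measurable_letter {I : Set ℕ} {i : ℕ} (hi : i ∈ I) :
    Measurable[lettersSigma α I] fun x : ℕ → α ↦ x i := by
  rw [measurable_iff_comap_le]
  exact le_iSup₂_of_le i hi le_rfl

lemma measurable_seqShift_letters (n : ℕ) :
    Measurable[lettersSigma α (Set.Ici n)] (seqShift (α := α) n) :=
  @measurable_pi_lambda _ _ _ (lettersSigma α (Set.Ici n)) _ _ fun m ↦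
    measurable_letter (by simp : n + m ∈ Set.Ici n)

lemma measurable_seqShift (n : ℕ) : Measurable (seqShift (α := α) n) :=
  measurable_pi_lambda _ fun _ ↦ measurable_pi_apply _

/-- Over a finite alphabet there are only finitely many prefixes of length `n`, so `p` may be
arbitrary. -/
lemma measurableSet_prefix [Finite α] [MeasurableSingletonClass α] (p : List α → Prop) (n : ℕ) :
    MeasurableSet[lettersSigma α (Set.Iio n)] {x : ℕ → α | p ((List.range n).map x)} := by
  have hr : Measurable[lettersSigma α (Set.Iio n)] fun (x : ℕ → α) (i : Fin n) ↦ x i :=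
    @measurable_pi_lambda _ _ _ (lettersSigma α (Set.Iio n)) _ _ fun i ↦ measurable_letter i.2
  have : {x : ℕ → α | p ((List.range n).map x)} =
      (fun (x : ℕ → α) (i : Fin n) ↦ x i) ⁻¹' {y | p (List.ofFn y)} := by
    ext x
    simp only [Set.mem_ofPred_eq, Set.mem_preimage]
    rw [List.ofFn_eq_map, ← List.map_coe_finRange_eq_range, List.map_map]
    rfl
  rw [this]
  exact hr (Set.toFinite _).measurableSet

variable [Finite α] [MeasurableSingletonClass α]

lemma measurableSet_omniTime_le (k n : ℕ) :
    MeasurableSet[lettersSigma α (Set.Iio n)] {x : ℕ → α | omniTime k x ≤ n} := by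
  simp_rw [omniTime_le_iff]
  exact measurableSet_prefix (fun s ↦ IsOmni k s) n

lemma measurable_omniTime (k : ℕ) : Measurable fun x : ℕ → α ↦ omniTime k x :=
  ENat.measurable_of_le_natCast fun n ↦ lettersSigma_le _ _ (measurableSet_omniTime_le k n)

lemma measurable_omniTimeReal (k : ℕ) : Measurable fun x : ℕ → α ↦ omniTimeReal k x :=
  (Measurable.of_discrete (f := fun t : ℕ∞ ↦ (t.toNat : ℝ))).comp (measurable_omniTime k)

lemma measurableSet_coverTime_le (S : Finset α) (n : ℕ) :
    MeasurableSet[lettersSigma α (Set.Iio n)] {x : ℕ → α | coverTime S x ≤ n} := by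
  simp_rw [coverTime_le_iff]
  exact measurableSet_prefix (fun s ↦ ∀ i ∈ S, i ∈ s) n

lemma measurable_coverTime (S : Finset α) : Measurable fun x : ℕ → α ↦ coverTime S x :=
  ENat.measurable_of_le_natCast fun n ↦ lettersSigma_le _ _ (measurableSet_coverTime_le S n)

end Sequences

/-! ### Strong Markov property of the i.i.d. sequence. -/

section Markov

variable {α : Type*} [MeasurableSpace α] (u : Measure α) [IsProbabilityMeasure u]

/-- The law of a sequence of independent letters with law `u`. -/
noncomputable abbrev iidLaw : Measure (ℕ → α) := Measure.infinitePi fun _ ↦ u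

lemma measurePreserving_seqShift (n : ℕ) :
    MeasurePreserving (seqShift n) (iidLaw u) (iidLaw u) := by
  refine ⟨measurable_seqShift n, ?_⟩
  exact Measure.map_infinitePi_infinitePi_of_inj (f := fun m : ℕ ↦ n + m)
    (P := fun _ : ℕ ↦ u) (add_right_injective n)

lemma indep_lettersSigma {I J : Set ℕ} (h : Disjoint I J) :
    Indep (lettersSigma α I) (lettersSigma α J) (iidLaw u) := by
  refine indep_iSup_of_disjoint (fun i ↦ (measurable_pi_apply i).comap_le) ?_ h
  exact iIndepFun_infinitePi (P := fun _ : ℕ ↦ u) (X := fun _ a ↦ a) fun _ ↦ measurable_id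

/-- At a deterministic time, the past is independent of the shifted sequence. -/
lemma measure_inter_preimage_seqShift {n : ℕ} {A B : Set (ℕ → α)}
    (hA : MeasurableSet[lettersSigma α (Set.Iio n)] A) (hB : MeasurableSet B) :
    iidLaw u (A ∩ seqShift n ⁻¹' B) = iidLaw u A * iidLaw u B := by
  have hI : Disjoint (Set.Iio n) (Set.Ici n) := Set.Iio_disjoint_Ici le_rfl
  rw [(Indep_iff _ _ _).1 (indep_lettersSigma u hI) A _ hA (measurable_seqShift_letters n hB),
    (measurePreserving_seqShift u n).measure_preimage hB.nullMeasurableSet]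

/-- At an almost surely finite stopping time `N`, the sequence shifted by `N` is independent of
`N` and has the law of the original sequence. -/
lemma map_stopping_seqShift {N : (ℕ → α) → ℕ∞}
    (hN : ∀ n : ℕ, MeasurableSet[lettersSigma α (Set.Iio n)] {x | N x ≤ n})
    (hfin : ∀ᵐ x ∂iidLaw u, N x ≠ ⊤) :
    Measurable (fun x ↦ ((N x).toNat, seqShift (N x).toNat x)) ∧
    (iidLaw u).map (fun x ↦ ((N x).toNat, seqShift (N x).toNat x)) =
      ((iidLaw u).map fun x ↦ (N x).toNat).prod (iidLaw u) := by
  have hNm : Measurable N :=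
    ENat.measurable_of_le_natCast fun n ↦ lettersSigma_le _ _ (hN n)
  have hNn : Measurable fun x ↦ (N x).toNat := Measurable.of_discrete.comp hNm
  have hθ : Measurable fun x ↦ seqShift (N x).toNat x := by
    refine measurable_pi_lambda _ fun m ↦ ?_
    exact (measurable_from_prod_countable_right
      (f := fun p : ℕ × (ℕ → α) ↦ p.2 (p.1 + m)) fun n ↦ measurable_pi_apply (n + m)).comp
      (hNn.prodMk measurable_id)
  have hNeq (n : ℕ) : MeasurableSet[lettersSigma α (Set.Iio n)] {x | N x = n} :=
    ENat.measurableSet_eq_natCast fun k hk ↦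
      lettersSigma_mono (Set.Iio_subset_Iio hk) _ (hN k)
  refine ⟨hNn.prodMk hθ, ?_⟩
  have : IsProbabilityMeasure ((iidLaw u).map fun x ↦ (N x).toNat) :=
    Measure.isProbabilityMeasure_map hNn.aemeasurable
  symm
  refine Measure.prod_eq fun s t hs ht ↦ ?_
  -- `toNat` sends `⊤` to `0`, so for `n = 0` the two events agree only up to the null set where `N`
  -- is infinite.
  have hae (n : ℕ) (C : Set (ℕ → α)) :
      iidLaw u ({x | (N x).toNat = n} ∩ C) = iidLaw u ({x | N x = n} ∩ C) := by
    apply measure_congr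
    filter_upwards [hfin] with x hx
    apply propext
    refine and_congr ?_ Iff.rfl
    change (N x).toNat = n ↔ N x = n
    rw [← ENat.natCast_toNat hx]
    simp
  have key (n : ℕ) : iidLaw u ({x | (N x).toNat = n} ∩ (fun x ↦ seqShift (N x).toNat x) ⁻¹' t) =
      iidLaw u {x | (N x).toNat = n} * iidLaw u t := by
    have h1 : {x | (N x).toNat = n} ∩ (fun x ↦ seqShift (N x).toNat x) ⁻¹' t =
        {x | (N x).toNat = n} ∩ seqShift n ⁻¹' t := by
      ext x
      simp only [Set.mem_inter_iff, Set.mem_ofPred_eq, Set.mem_preimage]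
      refine and_congr_right fun h ↦ ?_
      rw [h]
    have h2 := hae n Set.univ
    simp only [Set.inter_univ] at h2
    rw [h1, hae, measure_inter_preimage_seqShift u (hNeq n) ht, h2]
  have hdisj : Pairwise (Function.onFun Disjoint fun n : s ↦ {x | (N x).toNat = (n : ℕ)}) := by
    intro m n hmn
    refine Set.disjoint_left.2 fun x hx hy ↦ hmn (Subtype.ext ?_)
    exact (id hx : (N x).toNat = m).symm.trans hy
  have hmeas (n : ℕ) : MeasurableSet {x | (N x).toNat = n} := hNn (measurableSet_singleton n)
  rw [Measure.map_apply (hNn.prodMk hθ) (hs.prod ht), Measure.map_apply hNn hs]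
  have e1 : (fun x ↦ ((N x).toNat, seqShift (N x).toNat x)) ⁻¹' s ×ˢ t =
      ⋃ n : s, {x | (N x).toNat = (n : ℕ)} ∩ (fun x ↦ seqShift (N x).toNat x) ⁻¹' t := by
    ext x
    simp
  have e2 : (fun x ↦ (N x).toNat) ⁻¹' s = ⋃ n : s, {x | (N x).toNat = (n : ℕ)} := by
    ext x
    simp
  rw [e1, e2, measure_iUnion hdisj fun n ↦ hmeas n, measure_iUnion
    (fun m n hmn ↦ (hdisj hmn).mono Set.inter_subset_left Set.inter_subset_left)
    (fun n ↦ (hmeas n).inter (hθ ht)), ← ENNReal.tsum_mul_right]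
  exact tsum_congr fun n ↦ key n

section StoppingTime

variable {N : (ℕ → α) → ℕ∞}
  (hN : ∀ n : ℕ, MeasurableSet[lettersSigma α (Set.Iio n)] {x | N x ≤ n})
  (hfin : ∀ᵐ x ∂iidLaw u, N x ≠ ⊤)
include hN hfin

lemma measurePreserving_stopping_seqShift :
    MeasurePreserving (fun x ↦ seqShift (N x).toNat x) (iidLaw u) (iidLaw u) := by
  obtain ⟨hm, hmap⟩ := map_stopping_seqShift u hN hfin
  have : IsProbabilityMeasure ((iidLaw u).map fun x ↦ (N x).toNat) :=
    Measure.isProbabilityMeasure_map hm.fst.aemeasurable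
  refine ⟨hm.snd, ?_⟩
  rw [← Measure.snd_map_prodMk hm.fst, hmap, Measure.snd_prod]

lemma indepFun_stopping_seqShift :
    IndepFun (fun x ↦ (N x).toNat) (fun x ↦ seqShift (N x).toNat x) (iidLaw u) := by
  obtain ⟨hm, hmap⟩ := map_stopping_seqShift u hN hfin
  rw [indepFun_iff_map_prod_eq_prod_map_map hm.fst.aemeasurable hm.snd.aemeasurable, hmap,
    (measurePreserving_stopping_seqShift u hN hfin).map_eq]

end StoppingTime

end Markov

/-! ### A single coupon collection: tail, moments and the renewal step. -/

section Tail

variable {α : Type*} [Fintype α] [Nontrivial α] [MeasurableSpace α] [MeasurableSingletonClass α]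
  (u : Measure α) [IsProbabilityMeasure u]

lemma one_sub_inv_card_mem_Ioo (α : Type*) [Fintype α] [Nontrivial α] :
    1 - (Fintype.card α : ℝ)⁻¹ ∈ Set.Ioo 0 1 := by
  have : (1 : ℝ) < Fintype.card α := by exact_mod_cast Fintype.one_lt_card
  exact ⟨by linarith [inv_lt_one_of_one_lt₀ this], by
    linarith [inv_pos.2 (zero_lt_one.trans this)]⟩

omit [Fintype α] [Nontrivial α] [MeasurableSingletonClass α] in
lemma iidLaw_forall_lt_mem (B : Set α) (hB : MeasurableSet B) (n : ℕ) :
    iidLaw u {x | ∀ m < n, x m ∈ B} = u B ^ n := by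
  have := Measure.infinitePi_pi (μ := fun _ : ℕ ↦ u) (s := Finset.range n) (t := fun _ ↦ B)
    fun _ _ ↦ hB
  simp only [Finset.prod_const, Finset.card_range] at this
  rw [← this]
  congr 1
  ext x
  simp

variable (hu : ∀ i, u {i} = (Fintype.card α : ℝ≥0∞)⁻¹)
include hu

/-- Union bound over the letters still missing after `n` draws. -/
lemma coverTime_tail (S : Finset α) (n : ℕ) :
    iidLaw u {x | ¬ coverTime S x ≤ n} ≤
      ENNReal.ofReal (Fintype.card α * (1 - (Fintype.card α : ℝ)⁻¹) ^ n) := by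
  have hr := one_sub_inv_card_mem_Ioo α
  have hsub : {x : ℕ → α | ¬ coverTime S x ≤ n} ⊆ ⋃ i ∈ S, {x | ∀ m < n, x m ∈ ({i}ᶜ : Set α)} := by
    intro x hx
    simp only [Set.mem_ofPred_eq, coverTime_le_iff, not_forall] at hx
    obtain ⟨i, hi, hx⟩ := hx
    simp only [Set.mem_iUnion]
    refine ⟨i, hi, fun m hm h ↦ hx ?_⟩
    exact List.mem_map.2 ⟨m, List.mem_range.2 hm, h⟩
  have hcompl (i : α) : u {i}ᶜ = ENNReal.ofReal (1 - (Fintype.card α : ℝ)⁻¹) := by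
    rw [prob_compl_eq_one_sub (measurableSet_singleton i), hu, ENNReal.ofReal_sub _ (by positivity),
      ENNReal.ofReal_one, ENNReal.ofReal_inv_of_pos (by exact_mod_cast Fintype.card_pos),
      ENNReal.ofReal_natCast]
  calc iidLaw u {x | ¬ coverTime S x ≤ n}
      ≤ ∑ i ∈ S, iidLaw u {x | ∀ m < n, x m ∈ ({i}ᶜ : Set α)} :=
        (measure_mono hsub).trans (measure_biUnion_finset_le _ _)
    _ = S.card * ENNReal.ofReal (1 - (Fintype.card α : ℝ)⁻¹) ^ n := by
        simp_rw [iidLaw_forall_lt_mem u _ (measurableSet_singleton _).compl, hcompl]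
        simp
    _ ≤ Fintype.card α * ENNReal.ofReal (1 - (Fintype.card α : ℝ)⁻¹) ^ n := by
        gcongr
        exact S.card_le_univ
    _ = _ := by
        rw [ENNReal.ofReal_mul (by positivity), ENNReal.ofReal_pow hr.1.le, ENNReal.ofReal_natCast]

lemma coverTime_ne_top (S : Finset α) : ∀ᵐ x ∂iidLaw u, coverTime S x ≠ ⊤ := by
  have hr := one_sub_inv_card_mem_Ioo α
  rw [ae_iff]
  refine le_antisymm ?_ zero_le
  have hlim : Tendsto (fun n : ℕ ↦
      ENNReal.ofReal (Fintype.card α * (1 - (Fintype.card α : ℝ)⁻¹) ^ n)) atTop (𝓝 0) := by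
    rw [← ENNReal.ofReal_zero, ← mul_zero (Fintype.card α : ℝ)]
    exact ENNReal.tendsto_ofReal
      ((tendsto_pow_atTop_nhds_zero_of_lt_one hr.1.le hr.2).const_mul _)
  refine ge_of_tendsto' hlim fun n ↦ (measure_mono ?_).trans (coverTime_tail u hu S n)
  intro x hx
  simp only [Set.mem_ofPred_eq, not_not] at hx
  simp [hx]

lemma memLp_coverTime (S : Finset α) :
    MemLp (fun x ↦ ((coverTime S x).toNat : ℝ)) 2 (iidLaw u) := by
  obtain ⟨hr0, hr1⟩ := one_sub_inv_card_mem_Ioo α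
  set r := 1 - (Fintype.card α : ℝ)⁻¹
  have hN : Measurable fun x : ℕ → α ↦ (coverTime S x).toNat :=
    Measurable.of_discrete.comp (measurable_coverTime S)
  have hf : Measurable fun x : ℕ → α ↦ ((coverTime S x).toNat : ℝ) :=
    Measurable.of_discrete.comp hN
  rw [memLp_two_iff_integrable_sq hf.aestronglyMeasurable]
  refine ⟨(hf.pow_const 2).aestronglyMeasurable, ?_⟩
  rw [hasFiniteIntegral_iff_ofReal (ae_of_all _ fun x ↦ by positivity),
    ← lintegral_map (μ := iidLaw u) (f := fun n : ℕ ↦ ENNReal.ofReal ((n : ℝ) ^ 2))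
      Measurable.of_discrete hN, lintegral_countable']
  -- The event that the time equals `n + 1` is bounded by the tail at `n`; the division by `r` makes
  -- up for this shift.
  have hsum : Summable fun n : ℕ ↦ (Fintype.card α / r) * ((n : ℝ) ^ 2 * r ^ n) :=
    (summable_pow_mul_geometric_of_norm_lt_one 2
      (by rwa [Real.norm_of_nonneg hr0.le] : ‖r‖ < 1)).mul_left _
  refine lt_of_le_of_lt (ENNReal.tsum_le_tsum fun n ↦ ?_) hsum.tsum_ofReal_lt_top
  obtain _ | n := n
  · simp
  rw [Measure.map_apply hN (measurableSet_singleton _)]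
  have h1 : iidLaw u ((fun x ↦ (coverTime S x).toNat) ⁻¹' {n + 1}) ≤
      ENNReal.ofReal (Fintype.card α * r ^ n) := by
    refine (measure_mono ?_).trans (coverTime_tail u hu S n)
    intro x hx h
    have h2 := ENat.toNat_le_of_le_natCast h
    simp only [Set.mem_preimage, Set.mem_singleton_iff] at hx
    omega
  refine (mul_le_mul_right h1 _).trans ?_
  rw [← ENNReal.ofReal_mul (by positivity)]
  apply ENNReal.ofReal_le_ofReal
  apply le_of_eq
  field_simp
  ring

lemma lintegral_coverTime_eq_ofReal (S : Finset α) :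
    ∫⁻ x, (coverTime S x : ℝ≥0∞) ∂iidLaw u =
      ENNReal.ofReal (∫ x, ((coverTime S x).toNat : ℝ) ∂iidLaw u) := by
  rw [ofReal_integral_eq_lintegral_ofReal ((memLp_coverTime u hu S).integrable (by norm_num))
    (ae_of_all _ fun x ↦ by positivity)]
  refine lintegral_congr_ae ?_
  filter_upwards [coverTime_ne_top u hu S] with x hx
  rw [ENNReal.ofReal_natCast, ← ENat.toENNReal_coe, ENat.natCast_toNat hx]

omit hu [Nontrivial α] in
-- Conditioning on the first letter, which is independent of the later ones.
lemma lintegral_letter_seqShift (G : α → (ℕ → α) → ℝ≥0∞) (hG : ∀ i, Measurable (G i)) :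
    ∫⁻ x, G (x 0) (seqShift 1 x) ∂iidLaw u = ∑ i, u {i} * ∫⁻ x, G i x ∂iidLaw u := by
  have hsplit (x : ℕ → α) : G (x 0) (seqShift 1 x) =
      ∑ i, ({i} : Set α).indicator 1 (x 0) * G i (seqShift 1 x) := by
    rw [Finset.sum_eq_single (x 0)]
    · simp
    · intro i _ hi
      simp [hi.symm]
    · simp
  have hm0 (i : α) : Measurable fun x : ℕ → α ↦ ({i} : Set α).indicator (1 : α → ℝ≥0∞) (x 0) :=
    (measurable_one.indicator (measurableSet_singleton i)).comp (measurable_pi_apply 0)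
  have hGs (i : α) : Measurable fun x ↦ G i (seqShift 1 x) := (hG i).comp (measurable_seqShift 1)
  simp_rw [hsplit]
  rw [lintegral_finsetSum _ fun i _ ↦ (hm0 i).fun_mul (hGs i)]
  refine Finset.sum_congr rfl fun i _ ↦ ?_
  have h0 : Measurable[lettersSigma α (Set.Iio 1)] fun x : ℕ → α ↦ x 0 :=
    measurable_letter (by simp)
  have hind : Measurable (({i} : Set α).indicator (1 : α → ℝ≥0∞)) :=
    measurable_one.indicator (measurableSet_singleton i)
  refine (lintegral_mul_eq_lintegral_mul_lintegral_of_independent_measurableSpace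
    (lettersSigma_le (Set.Iio 1)) (lettersSigma_le (Set.Ici 1))
    (indep_lettersSigma u (Set.Iio_disjoint_Ici le_rfl)) (hind.comp h0)
    ((hG i).comp (measurable_seqShift_letters 1))).trans ?_
  simp only [Function.comp_apply]
  rw [(measurePreserving_seqShift u 1).lintegral_comp (hG i),
    (measurePreserving_eval_infinitePi (fun _ : ℕ ↦ u) 0).lintegral_comp
    hind, lintegral_indicator_one (measurableSet_singleton i)]

lemma integral_coverTime (S : Finset α) :
    ∫ x, ((coverTime S x).toNat : ℝ) ∂iidLaw u = Fintype.card α * (harmonic S.card : ℚ) := by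
  classical
  induction hc : S.card generalizing S with
  | zero =>
    rw [Finset.card_eq_zero] at hc
    simp [hc, coverTime_empty]
  | succ j ih =>
    have hS : S.Nonempty := Finset.card_pos.1 (by omega)
    have hpos (T : Finset α) : 0 ≤ ∫ x, ((coverTime T x).toNat : ℝ) ∂iidLaw u :=
      integral_nonneg fun x ↦ by positivity
    have ha : (0 : ℝ) < Fintype.card α := by exact_mod_cast Fintype.card_pos
    have hrec : ∫⁻ x, (coverTime S x : ℝ≥0∞) ∂iidLaw u =
        1 + ∑ i, u {i} * ∫⁻ x, (coverTime (S.erase i) x : ℝ≥0∞) ∂iidLaw u := by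
      rw [← lintegral_letter_seqShift u (fun i x ↦ (coverTime (S.erase i) x : ℝ≥0∞))
        fun i ↦ Measurable.of_discrete.comp (measurable_coverTime _)]
      simp_rw [fun x ↦ coverTime_of_nonempty hS x, ENat.toENNReal_add, ENat.toENNReal_one]
      rw [lintegral_add_left measurable_const, lintegral_one, measure_univ]
    set m := fun T : Finset α ↦ ∫ x, ((coverTime T x).toNat : ℝ) ∂iidLaw u with hm
    -- The unknown `m S` also occurs on the right, once for each letter outside `S`. The equation is
    -- moved from `ℝ≥0∞` to `ℝ`, where finiteness of the means allows it to be solved: the increment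
    -- is `card α / (j + 1)`.
    have hreal : m S = 1 + ∑ i, (Fintype.card α : ℝ)⁻¹ * m (S.erase i) := by
      simp_rw [lintegral_coverTime_eq_ofReal u hu, hu] at hrec
      have h := congrArg ENNReal.toReal hrec
      rw [ENNReal.toReal_ofReal (hpos S), ENNReal.toReal_add ENNReal.one_ne_top,
        ENNReal.toReal_sum] at h
      · simpa [ENNReal.toReal_ofReal (hpos _)] using h
      · intro i _
        exact ENNReal.mul_ne_top (by simp) ENNReal.ofReal_ne_top
      · exact ENNReal.sum_ne_top.2 fun i _ ↦ ENNReal.mul_ne_top (by simp) ENNReal.ofReal_ne_top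
    have herase (i : α) : m (S.erase i) =
        if i ∈ S then Fintype.card α * ((harmonic j : ℚ) : ℝ) else m S := by
      split_ifs with hi
      · exact ih _ (by rw [Finset.card_erase_of_mem hi, hc, Nat.add_sub_cancel])
      · rw [Finset.erase_eq_of_notMem hi]
    simp_rw [herase, ← Finset.mul_sum, Finset.sum_ite, Finset.sum_const, nsmul_eq_mul] at hreal
    have hcard := Finset.card_filter_add_card_filter_not (s := Finset.univ) (fun i ↦ i ∈ S)
    have hfilter : Finset.univ.filter (fun i ↦ i ∈ S) = S := by
      ext
      simp
    rw [hfilter, hc, Finset.card_univ] at hcard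
    rw [hfilter, hc] at hreal
    have hcard' : ((Finset.univ.filter fun i ↦ i ∉ S).card : ℝ) =
        Fintype.card α - ((j + 1 : ℕ) : ℝ) := by
      rw [← hcard]
      push_cast
      ring
    rw [hcard'] at hreal
    have hj : (0 : ℝ) < ((j + 1 : ℕ) : ℝ) := by positivity
    change m S = _
    rw [harmonic_succ, Rat.cast_add, Rat.cast_inv, Rat.cast_natCast]
    field_simp at hreal ⊢
    linarith

/-- The time of the first complete coupon collection is square integrable. -/
lemma memLp_omniTimeReal_one : MemLp (omniTimeReal 1) 2 (iidLaw u) := by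
  have : omniTimeReal 1 = fun x : ℕ → α ↦ ((coverTime Finset.univ x).toNat : ℝ) := by
    funext x
    rw [omniTimeReal, omniTime_one]
  rw [this]
  exact memLp_coverTime u hu _

lemma integral_omniTimeReal_one :
    ∫ x, omniTimeReal 1 x ∂iidLaw u = Fintype.card α * (harmonic (Fintype.card α) : ℚ) := by
  simp_rw [omniTimeReal, omniTime_one]
  exact integral_coverTime u hu Finset.univ

/-- If the time were almost surely constant, take `n` above that constant: with positive probability
the first `n` letters all coincide, and then the collection is still incomplete at time `n`. -/
lemma variance_omniTimeReal_one_pos : 0 < Var[omniTimeReal 1; iidLaw u] := by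
  refine (variance_nonneg _ _).lt_of_ne' fun h0 ↦ ?_
  have hconst := ae_eq_integral_of_variance_eq_zero (memLp_omniTimeReal_one u hu) h0
  obtain ⟨n, hn⟩ := exists_nat_gt (∫ x, omniTimeReal 1 x ∂iidLaw u)
  obtain ⟨i, j, hij⟩ := exists_pair_ne α
  have hpos : iidLaw u {x | ∀ m < n, x m ∈ ({i} : Set α)} ≠ 0 := by
    rw [iidLaw_forall_lt_mem u _ (measurableSet_singleton i), hu]
    simp
  refine hpos (measure_mono_null ?_ (ae_iff.1 (hconst.and (coverTime_ne_top u hu Finset.univ))))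
  rintro x hx ⟨h1, h2⟩
  rw [← h1, omniTimeReal, omniTime_one, Nat.cast_lt] at hn
  have h3 : coverTime Finset.univ x ≤ n := by
    rw [← ENat.natCast_toNat h2]
    exact_mod_cast hn.le
  obtain ⟨m, hm, hxm⟩ := List.mem_map.1 ((coverTime_le_iff _ x n).1 h3 j (Finset.mem_univ j))
  exact hij ((hx m (List.mem_range.1 hm)).symm.trans hxm)

lemma omniTime_one_ne_top : ∀ᵐ x ∂iidLaw u, omniTime 1 x ≠ ⊤ := by
  simp_rw [omniTime_one]
  exact coverTime_ne_top u hu _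

lemma omniTime_ne_top (k : ℕ) : ∀ᵐ x ∂iidLaw u, omniTime k x ≠ ⊤ := by
  have h1 := omniTime_one_ne_top u hu
  induction k with
  | zero => simp [omniTime_zero]
  | succ k ih =>
    have hq := measurePreserving_stopping_seqShift u (fun n ↦ measurableSet_omniTime_le 1 n) h1
    filter_upwards [h1, hq.quasiMeasurePreserving.ae ih] with x hx1 hx2
    rw [omniTime_succ]
    exact WithTop.add_ne_top.2 ⟨hx1, hx2⟩

/-- The waiting times have the laws of the partial sums of a random walk. -/
lemma map_omniTimeReal_succ (k : ℕ) :
    (iidLaw u).map (omniTimeReal (k + 1)) =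
      (iidLaw u).map (omniTimeReal 1) ∗ (iidLaw u).map (omniTimeReal k) := by
  have h1 := omniTime_one_ne_top u hu
  have hq := measurePreserving_stopping_seqShift u (fun n ↦ measurableSet_omniTime_le 1 n) h1
  have hind := (indepFun_stopping_seqShift u (fun n ↦ measurableSet_omniTime_le 1 n) h1).comp
    (φ := fun n : ℕ ↦ (n : ℝ)) Measurable.of_discrete (measurable_omniTimeReal k)
  have hsum : omniTimeReal (k + 1) =ᵐ[iidLaw u]
      omniTimeReal 1 + (omniTimeReal k ∘ fun x ↦ seqShift (omniTime 1 x).toNat x) := by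
    filter_upwards [h1, hq.quasiMeasurePreserving.ae (omniTime_ne_top u hu k)] with x hx1 hx2
    simp only [omniTimeReal, Pi.add_apply, Function.comp_apply]
    rw [omniTime_succ, ENat.toNat_add hx1 hx2, Nat.cast_add]
  have hmap := Measure.map_map (measurable_omniTimeReal k) hq.measurable (μ := iidLaw u)
  rw [hq.map_eq] at hmap
  rw [Measure.map_congr hsum, hmap]
  exact IndepFun.map_add_eq_map_conv_map (measurable_omniTimeReal 1)
    ((measurable_omniTimeReal k).comp hq.measurable) hind

end Tail

/-! ### Central limit theorem for distribution functions. -/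

section RandomWalk

/-- The central limit theorem for distribution functions of sums of independent copies of a
square integrable random variable. -/
lemma tendsto_measureReal_sum_le (ν : Measure ℝ) [IsProbabilityMeasure ν] (h2 : MemLp id 2 ν)
    (hv : 0 < Var[id; ν]) (x : ℝ) :
    Tendsto (fun k : ℕ ↦ (iidLaw ν).real
        {y | (∑ i ∈ Finset.range k, y i - k * ν[id]) / (√k * √(Var[id; ν])) ≤ x})
      atTop (𝓝 (1 / √(2 * Real.pi) * ∫ u in Set.Iic x, Real.exp (-u ^ 2 / 2))) := by
  have hlaw (i : ℕ) : HasLaw (fun y : ℕ → ℝ ↦ y i) ν (iidLaw ν) :=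
    (measurePreserving_eval_infinitePi (fun _ : ℕ ↦ ν) i).hasLaw
  have hind : iIndepFun (fun (i : ℕ) (y : ℕ → ℝ) ↦ y i) (iidLaw ν) :=
    iIndepFun_infinitePi (P := fun _ : ℕ ↦ ν) (X := fun _ a ↦ a) fun _ ↦ measurable_id
  have hident (i : ℕ) : IdentDistrib (fun y : ℕ → ℝ ↦ y i) (fun y ↦ y 0) (iidLaw ν) (iidLaw ν) :=
    ⟨(hlaw i).aemeasurable, (hlaw 0).aemeasurable, by rw [(hlaw i).map_eq, (hlaw 0).map_eq]⟩
  have hmem : MemLp (fun y : ℕ → ℝ ↦ y 0) 2 (iidLaw ν) :=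
    h2.comp_measurePreserving (measurePreserving_eval_infinitePi (fun _ : ℕ ↦ ν) 0)
  have hmean : ∫ y, y 0 ∂iidLaw ν = ν[id] := (hlaw 0).integral_eq
  have hvar : Var[fun y ↦ y 0; iidLaw ν] = Var[id; ν] := (hlaw 0).variance_eq
  have hclt : TendstoInDistribution (fun (k : ℕ) (y : ℕ → ℝ) ↦
      (√k)⁻¹ * (∑ i ∈ Finset.range k, y i - k * ν[id]) / √(Var[id; ν])) atTop
      (fun t : ℝ ↦ t / √(Var[id; ν])) (fun _ ↦ iidLaw ν)
      (gaussianReal 0 Var[id; ν].toNNReal) := by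
    have h := tendstoInDistribution_inv_sqrt_mul_sum_sub (P := iidLaw ν)
      (X := fun (i : ℕ) (y : ℕ → ℝ) ↦ y i) (Y := id)
      (P' := gaussianReal 0 Var[id; ν].toNNReal) (hvar ▸ HasLaw.id) hmem hind hident
    rw [hmean] at h
    exact h.continuous_comp (g := fun t ↦ t / √(Var[id; ν])) (by fun_prop)
  have hgauss : (gaussianReal 0 Var[id; ν].toNNReal).map (fun t ↦ t / √(Var[id; ν])) =
      gaussianReal 0 1 := by
    rw [gaussianReal_map_div_const, zero_div]
    congr 1
    ext
    simp [hv.le, hv.ne']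
  -- Portmanteau: the boundary of the half-line is one point, which is null for the Gaussian limit.
  have hlim := ProbabilityMeasure.tendsto_measure_of_null_frontier_of_tendsto' hclt.tendsto
    (E := Set.Iic x) (by
      have := nullSingletonClass_gaussianReal (μ := 0) (v := 1) one_ne_zero
      rw [ProbabilityMeasure.coe_mk, hgauss, frontier_Iic]
      exact measure_singleton x)
  simp only [ProbabilityMeasure.coe_mk, hgauss] at hlim
  have hlim' := (ENNReal.tendsto_toReal (measure_ne_top _ _)).comp hlim
  have hval : (gaussianReal 0 1 (Set.Iic x)).toReal =
      1 / √(2 * Real.pi) * ∫ u in Set.Iic x, Real.exp (-u ^ 2 / 2) := by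
    rw [gaussianReal_apply_eq_integral 0 one_ne_zero, ENNReal.toReal_ofReal
      (setIntegral_nonneg measurableSet_Iic fun t _ ↦ gaussianPDFReal_nonneg 0 1 t),
      ← integral_const_mul]
    simp [gaussianPDFReal_def]
  rw [hval] at hlim'
  refine hlim'.congr fun k ↦ ?_
  simp only [Function.comp_apply]
  rw [Measure.map_apply_of_aemeasurable (hclt.forall_aemeasurable k) measurableSet_Iic,
    measureReal_def]
  congr 2
  ext y
  simp only [Set.mem_preimage, Set.mem_Iic, Set.mem_ofPred_eq]
  rw [inv_mul_eq_div, div_div]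

end RandomWalk

/-! ### Omni waiting times as random walks, and the limit theorem. -/

section Omni

variable {α : Type*} [Fintype α] [Nontrivial α] [MeasurableSpace α] [MeasurableSingletonClass α]
  (u : Measure α) [IsProbabilityMeasure u]

lemma map_omniTimeReal_eq_map_sum (hu : ∀ i, u {i} = (Fintype.card α : ENNReal)⁻¹)
    {ν : Measure ℝ} [IsProbabilityMeasure ν] (hν : ν = (iidLaw u).map (omniTimeReal 1)) (k : ℕ) :
    (iidLaw u).map (omniTimeReal k) =
      (iidLaw ν).map fun y ↦ ∑ i ∈ Finset.range k, y i := by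
  induction k with
  | zero =>
    have : omniTimeReal (α := α) 0 = fun _ ↦ 0 := by
      funext x
      simp [omniTimeReal, omniTime_zero]
    simp [this]
  | succ k ih =>
    have hind : iIndepFun (fun (i : ℕ) (y : ℕ → ℝ) ↦ y i) (iidLaw ν) :=
      iIndepFun_infinitePi (P := fun _ : ℕ ↦ ν) (X := fun _ a ↦ a) fun _ ↦ measurable_id
    have hk := hind.indepFun_finsetSum_of_notMem (fun _ ↦ measurable_pi_apply _)
      (Finset.notMem_range_self (n := k))
    have hconv := hk.map_add_eq_map_conv_map (by fun_prop) (by fun_prop)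
    rw [(measurePreserving_eval_infinitePi (fun _ : ℕ ↦ ν) k).map_eq] at hconv
    have hsum : (∑ i ∈ Finset.range k, fun y : ℕ → ℝ ↦ y i) =
        fun y ↦ ∑ i ∈ Finset.range k, y i := by
      ext
      simp
    rw [hsum] at hconv
    -- The renewal step adds a collection in front, the partial sum adds one at the end;
    -- commutativity of convolution reconciles them.
    rw [map_omniTimeReal_succ u hu, ih, ← hν, Measure.conv_comm, ← hconv]
    congr 1
    ext y
    simp [Finset.sum_range_succ]

lemma tendsto_iidLaw_omniTimeReal_le (hu : ∀ i, u {i} = (Fintype.card α : ENNReal)⁻¹) (x : ℝ) :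
    Tendsto (fun k : ℕ ↦ (iidLaw u).real {s | (omniTimeReal k s
        - (k : ℝ) * (Fintype.card α * ((harmonic (Fintype.card α) : ℚ) : ℝ)))
          / (√k * √(Var[omniTimeReal 1; iidLaw u])) ≤ x})
      atTop (𝓝 (1 / √(2 * Real.pi) * ∫ u in Set.Iic x, Real.exp (-u ^ 2 / 2))) := by
  have hT : HasLaw (omniTimeReal 1) ((iidLaw u).map (omniTimeReal 1)) (iidLaw u) :=
    ⟨(measurable_omniTimeReal 1).aemeasurable, rfl⟩
  obtain ⟨ν, hν⟩ : ∃ ν, ν = (iidLaw u).map (omniTimeReal 1) := ⟨_, rfl⟩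
  have : IsProbabilityMeasure ν :=
    hν ▸ Measure.isProbabilityMeasure_map (measurable_omniTimeReal 1).aemeasurable
  rw [← hν] at hT
  have h2 : MemLp id 2 ν := by
    rw [hν, memLp_map_measure_iff aestronglyMeasurable_id
      (measurable_omniTimeReal 1).aemeasurable]
    exact memLp_omniTimeReal_one u hu
  have hmean : ν[id] = Fintype.card α * ((harmonic (Fintype.card α) : ℚ) : ℝ) := by
    rw [← integral_omniTimeReal_one u hu]
    exact hT.integral_eq.symm
  have hlim := tendsto_measureReal_sum_le ν h2
    (hT.variance_eq ▸ variance_omniTimeReal_one_pos u hu) x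
  refine hlim.congr fun k ↦ ?_
  rw [← hT.variance_eq, hmean]
  set c := (k : ℝ) * (Fintype.card α * ((harmonic (Fintype.card α) : ℚ) : ℝ))
  set d := √(k : ℝ) * √(Var[omniTimeReal 1; iidLaw u])
  have hset : MeasurableSet {t : ℝ | (t - c) / d ≤ x} :=
    measurableSet_le (by fun_prop) measurable_const
  have h := congrArg (fun m : Measure ℝ ↦ m.real {t | (t - c) / d ≤ x})
    (map_omniTimeReal_eq_map_sum u hu hν k)
  simp only [map_measureReal_apply (measurable_omniTimeReal k) hset,
    map_measureReal_apply (μ := iidLaw ν)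
      (f := fun y ↦ ∑ i ∈ Finset.range k, y i) (by fun_prop) hset] at h
  exact h.symm

end Omni

theorem theorem5p1 {Ω : Type*} [MeasurableSpace Ω] (P : Measure Ω) [IsProbabilityMeasure P]
    (a : ℕ) (ha : 2 ≤ a) (X : ℕ → Ω → Fin a)
    (hunif : ∀ n, HasLaw (X n) (uniformOn (Set.univ : Set (Fin a))) P)
    (hindep : iIndepFun X P) :
    (∀ k : ℕ, AEMeasurable (fun ω ↦ omniTimeReal k (fun n ↦ X n ω)) P ∧
      ∀ᵐ ω ∂P, omniTime k (fun n ↦ X n ω) ≠ ⊤) ∧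
    MemLp (fun ω ↦ omniTimeReal 1 (fun n ↦ X n ω)) 2 P ∧
    0 < couponStdDev X P ∧
    ∀ x : ℝ, Tendsto
      (fun k : ℕ ↦ P.real {ω | (omniTimeReal k (fun n ↦ X n ω)
          - (k : ℝ) * (a : ℝ) * ((harmonic a : ℚ) : ℝ)) / (√(k : ℝ) * couponStdDev X P) ≤ x})
      atTop
      (𝓝 (1 / √(2 * Real.pi) * ∫ u in Set.Iic x, Real.exp (-u ^ 2 / 2))) := by
  have : Nontrivial (Fin a) := Fin.nontrivial_iff_two_le.2 ha
  have hprob : IsProbabilityMeasure (uniformOn (Set.univ : Set (Fin a))) :=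
    isProbabilityMeasure_uniformOn Set.finite_univ Set.univ_nonempty
  have hu (i : Fin a) : uniformOn (Set.univ : Set (Fin a)) {i} =
      (Fintype.card (Fin a) : ENNReal)⁻¹ := by
    rw [uniformOn_univ, Measure.count_singleton, one_div]
  -- All the claims depend only on the joint law of the letters, so they transfer from the canonical
  -- sequence space.
  have hlaw : HasLaw (fun ω n ↦ X n ω) (iidLaw (uniformOn (Set.univ : Set (Fin a)))) P :=
    hindep.hasLaw_infinitePi hunif (aemeasurable_pi_iff.2 fun n ↦ (hunif n).aemeasurable)
  generalize uniformOn (Set.univ : Set (Fin a)) = u at hprob hu hlaw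
  have hvar : Var[fun ω ↦ omniTimeReal 1 (fun n ↦ X n ω); P] =
      Var[omniTimeReal 1; iidLaw u] := by
    have h1 : HasLaw (omniTimeReal 1) ((iidLaw u).map (omniTimeReal 1)) (iidLaw u) :=
      ⟨(measurable_omniTimeReal 1).aemeasurable, rfl⟩
    rw [h1.variance_eq]
    exact (h1.fun_comp hlaw).variance_eq
  refine ⟨fun k ↦ ⟨(measurable_omniTimeReal k).comp_aemeasurable hlaw.aemeasurable, ?_⟩, ?_, ?_,
    fun x ↦ ?_⟩
  · have h := omniTime_ne_top u hu k
    rw [← hlaw.map_eq] at h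
    exact ae_of_ae_map hlaw.aemeasurable h
  · have h := memLp_omniTimeReal_one u hu
    rw [← hlaw.map_eq] at h
    exact h.comp_of_map hlaw.aemeasurable
  · rw [couponStdDev, hvar]
    exact Real.sqrt_pos.2 (variance_omniTimeReal_one_pos u hu)
  · refine (tendsto_iidLaw_omniTimeReal_le u hu x).congr fun k ↦ ?_
    rw [couponStdDev, hvar, Fintype.card_fin, ← mul_assoc]
    refine (hlaw.measureReal_eq (measurableSet_le ?_ measurable_const)).symm
    exact ((measurable_omniTimeReal k).sub_const _).div_const _
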